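/- Let $\mathcal P_3=\{(\theta_1,\theta_2,\theta_3)\in\mathbb R^3 : \theta_1,\theta_2,\theta_3>0,\ \theta_1+\theta_2+\theta_3=1\}$, a $2$-dimensional smooth manifold. For $\alpha\in\mathbb R$ let $g_\alpha$ be the Riemannian metric on $\mathcal P_3$ that is the pull-back of the Euclidean metric of $\mathbb R^3$ under the map $\phi_\alpha:\mathcal P_3\to\mathbb R^3$, $$\phi_\alpha(\theta)=\begin{cases}\frac{2}{1-\alpha}\left(\theta_1^{\frac{1-\alpha}{2}},\theta_2^{\frac{1-\alpha}{2}},\theta_3^{\frac{1-\alpha}{2}}\right), & \alpha\neq 1,\\ (\log\theta_1,\log\theta_2,\log\theta_3), & \alpha=1.\end{cases}$$ Then for every $\alpha\in\mathbb R$ and every $\theta=(\theta_1,\theta_2,\theta_3)\in\mathcal P_3$ the scalar curvature of $(\mathcal P_3,g_\alpha)$ at $\theta$ (the full trace $\sum_{t,s}g_\alpha(R(A_t,A_s)A_s,A_t)$ over a $g_\alpha$-orthonormal basis $(A_t)$ of the tangent space at $\theta$, with $R(X,Y)=[\nabla_X,\nabla_Y]-\nabla_{[X,Y]}$ for the Levi-Civita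 connection $\nabla$, i.e. twice the Gaussian curvature) is $$\mathrm{Scal}(\theta)=\frac{(1+\alpha)^2}{2}\,\frac{\theta_1^{\alpha}\theta_2^{\alpha}\theta_3^{\alpha}}{\left(\theta_1^{\alpha+1}+\theta_2^{\alpha+1}+\theta_3^{\alpha+1}\right)^2}.$$ -/

import Mathlib

noncomputable section

namespace RiemannCoord

/-- The partial derivative `∂ᵢ F` of a map defined on (an open subset of) `ℝᵐ`. -/
def pderiv {m : ℕ} {E : Type*} [NormedAddCommGroup E] [NormedSpace ℝ E]
    (i : Fin m) (F : (Fin m → ℝ) → E) (x : Fin m → ℝ) : E :=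
  fderiv ℝ F x (Pi.single i 1)

/-- The coefficient matrix `g_{ij} = ⟨∂ᵢ F, ∂ⱼ F⟩` of the pull-back along `F : ℝᵐ → ℝⁿ` of the
canonical metric `g_c(u, v) = ∑ₖ uₖ vₖ` of `ℝⁿ`. -/
def pullbackMetric {m n : ℕ} (F : (Fin m → ℝ) → (Fin n → ℝ)) (x : Fin m → ℝ) :
    Matrix (Fin m) (Fin m) ℝ :=
  Matrix.of fun i j => ∑ k, pderiv i F x k * pderiv j F x k

/-- The Christoffel symbol `Γᵏᵢⱼ` of the Levi-Civita connection of `g`: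
`∇_{∂ᵢ} ∂ⱼ = ∑ₖ Γᵏᵢⱼ ∂ₖ`. -/
def christoffel {m : ℕ} (g : (Fin m → ℝ) → Matrix (Fin m) (Fin m) ℝ)
    (k i j : Fin m) (x : Fin m → ℝ) : ℝ :=
  (1 / 2) * ∑ l, (g x)⁻¹ k l *
    (pderiv i (fun y => g y j l) x + pderiv j (fun y => g y i l) x
      - pderiv l (fun y => g y i j) x)

/-- The component `Rˡᵢⱼₖ` of the Riemann curvature tensor
`R(X, Y)Z = ∇_X ∇_Y Z - ∇_Y ∇_X Z - ∇_{[X, Y]} Z`, with `R(∂ᵢ, ∂ⱼ)∂ₖ = ∑ₗ Rˡᵢⱼₖ ∂ₗ`. -/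
def riemann {m : ℕ} (g : (Fin m → ℝ) → Matrix (Fin m) (Fin m) ℝ)
    (l i j k : Fin m) (x : Fin m → ℝ) : ℝ :=
  pderiv i (christoffel g l j k) x - pderiv j (christoffel g l i k) x
    + ∑ a, (christoffel g a j k x * christoffel g l i a x
      - christoffel g a i k x * christoffel g l j a x)

/-- The Ricci tensor `Ric(∂ⱼ, ∂ₖ)`, the trace of `X ↦ R(X, ∂ⱼ)∂ₖ`. -/
def ricci {m : ℕ} (g : (Fin m → ℝ) → Matrix (Fin m) (Fin m) ℝ)
    (j k : Fin m) (x : Fin m → ℝ) : ℝ :=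
  ∑ i, riemann g i i j k x

/-- The scalar curvature `∑ g^{jk} Ric(∂ⱼ, ∂ₖ)`. Equivalently, for an orthonormal basis `A` of the
tangent space, `∑_{t,s} g(R(A_t, A_s)A_s, A_t)`. -/
def scalar {m : ℕ} (g : (Fin m → ℝ) → Matrix (Fin m) (Fin m) ℝ) (x : Fin m → ℝ) : ℝ :=
  ∑ j, ∑ k, (g x)⁻¹ j k * ricci g j k x

end RiemannCoord

namespace AlphaGeometry

/-- `𝒫ₙ`: the strictly positive probability distributions on `n` points. -/
def P (n : ℕ) : Set (Fin n → ℝ) :=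
  {θ | (∀ k, 0 < θ k) ∧ ∑ k, θ k = 1}

/-- The map `φ_{α,n}`. -/
def phi (α : ℝ) (n : ℕ) (θ : Fin n → ℝ) : Fin n → ℝ := fun k =>
  if α = 1 then Real.log (θ k) else 2 / (1 - α) * θ k ^ ((1 - α) / 2)

/-- The global chart `(θ₁, …, θ_{m+1}) ↦ (θ₁, …, θ_m)` of the `m`-dimensional manifold
`𝒫_{m+1}`. -/
def chart {m : ℕ} (θ : Fin (m + 1) → ℝ) : Fin m → ℝ := fun i => θ i.castSucc

/-- The inverse `(x₁, …, x_m) ↦ (x₁, …, x_m, 1 - ∑ xᵢ)` of the global chart. -/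
def param {m : ℕ} (x : Fin m → ℝ) : Fin (m + 1) → ℝ :=
  Fin.snoc (α := fun _ => ℝ) x (1 - ∑ i, x i)

theorem param_chart {m : ℕ} {θ : Fin (m + 1) → ℝ} (hθ : θ ∈ P (m + 1)) :
    param (chart θ) = θ := by
  have h := hθ.2
  rw [Fin.sum_univ_castSucc] at h
  funext k
  refine Fin.lastCases ?_ (fun i => ?_) k
  · simp only [param, chart, Fin.snoc_last]
    linarith
  · simp [param, chart]

/-- The metric `g_α` of `𝒫_{m+1}` in the global chart: the pull-back of the canonical metric of
`ℝ^{m+1}` along `φ_α`. -/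
def metric (α : ℝ) (m : ℕ) : (Fin m → ℝ) → Matrix (Fin m) (Fin m) ℝ :=
  RiemannCoord.pullbackMetric fun x => phi α (m + 1) (param x)

/-- The scalar curvature of `(𝒫_{m+1}, g_α)` at the point `θ`. -/
def Scal (α : ℝ) {m : ℕ} (θ : Fin (m + 1) → ℝ) : ℝ :=
  RiemannCoord.scalar (metric α m) (chart θ)

end AlphaGeometry

end

noncomputable section

/-! ### Calculus of partial derivatives on `ℝ²`. -/

namespace RiemannCoord

/-! For every `α`, each component of `φ_α` has derivative `t ^ (-(1 + α) / 2)`, so the metric is `∑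
w(θₖ) dθₖ²` restricted to the plane `∑ θₖ = 1`, with `w t = t ^ (-(1 + α))`
(`metric_eqOn_separableMetric`). For any positive `w`, `scalar_eq` gives the curvature in terms of
`w` and `w'` alone: the second derivatives cancel. For the power weight, `w' = -(1 + α) w / t`, so
the numerator is `(1 + α)² w₀w₁w₂ (∑ θₖ) / (θ₀θ₁θ₂)` and the determinant is `w₀w₁w₂ ∑ θₖ ^ (α + 1)`;
then `∑ θₖ = 1` gives the formula. -/

/-- The linear functional on `ℝ²` with coefficients `p` and `q`. -/
def covector (p q : ℝ) : (Fin 2 → ℝ) →L[ℝ] ℝ :=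
  p • ContinuousLinearMap.proj 0 + q • ContinuousLinearMap.proj 1

theorem covector_apply (p q : ℝ) (v : Fin 2 → ℝ) : covector p q v = p * v 0 + q * v 1 := by
  simp [covector]

/-- `F` is differentiable at `x`, with partial derivatives `p` and `q`. -/
def HasPartials (F : (Fin 2 → ℝ) → ℝ) (p q : ℝ) (x : Fin 2 → ℝ) : Prop :=
  HasFDerivAt F (covector p q) x

namespace HasPartials

variable {F G : (Fin 2 → ℝ) → ℝ} {p q p' q' : ℝ} {x : Fin 2 → ℝ}

theorem pderiv_zero (h : HasPartials F p q x) : pderiv 0 F x = p := by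
  rw [pderiv, HasFDerivAt.fderiv h, covector_apply]
  simp

theorem pderiv_one (h : HasPartials F p q x) : pderiv 1 F x = q := by
  rw [pderiv, HasFDerivAt.fderiv h, covector_apply]
  simp

theorem congr_of_eventuallyEq (h : HasPartials F p q x) (hG : G =ᶠ[nhds x] F) :
    HasPartials G p q x :=
  HasFDerivAt.congr_of_eventuallyEq h hG

theorem add (hF : HasPartials F p q x) (hG : HasPartials G p' q' x) :
    HasPartials (fun y => F y + G y) (p + p') (q + q') x := by
  refine (HasFDerivAt.add hF hG).congr_fderiv ?_
  ext v
  simp only [_root_.add_apply, covector_apply]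
  ring

theorem sub (hF : HasPartials F p q x) (hG : HasPartials G p' q' x) :
    HasPartials (fun y => F y - G y) (p - p') (q - q') x := by
  refine (HasFDerivAt.sub hF hG).congr_fderiv ?_
  ext v
  simp only [_root_.sub_apply, covector_apply]
  ring

theorem neg (hF : HasPartials F p q x) : HasPartials (fun y => -F y) (-p) (-q) x := by
  refine (HasFDerivAt.neg hF).congr_fderiv ?_
  ext v
  simp only [_root_.neg_apply, covector_apply]
  ring

theorem mul (hF : HasPartials F p q x) (hG : HasPartials G p' q' x) :
    HasPartials (fun y => F y * G y) (p * G x + F x * p') (q * G x + F x * q') x := by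
  refine (HasFDerivAt.mul hF hG).congr_fderiv ?_
  ext v
  simp only [_root_.add_apply, _root_.smul_apply, smul_eq_mul,
    covector_apply]
  ring

theorem scomp (hF : HasPartials F p q x) {f : ℝ → ℝ} {f' : ℝ} (hf : HasDerivAt f f' (F x)) :
    HasPartials (fun y => f (F y)) (f' * p) (f' * q) x := by
  refine (HasDerivAt.comp_hasFDerivAt x hf hF).congr_fderiv ?_
  ext v
  simp only [_root_.smul_apply, smul_eq_mul, covector_apply]
  ring

theorem div (hF : HasPartials F p q x) (hG : HasPartials G p' q' x) (h0 : G x ≠ 0) :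
    HasPartials (fun y => F y / G y) ((p * G x - F x * p') / G x ^ 2)
      ((q * G x - F x * q') / G x ^ 2) x := by
  have h := hF.mul (hG.scomp (hasDerivAt_inv h0))
  simp only [div_eq_mul_inv] at h ⊢
  convert h using 1 <;> field_simp <;> ring

theorem coord_zero (x : Fin 2 → ℝ) : HasPartials (fun y => y 0) 1 0 x := by
  refine (ContinuousLinearMap.proj (R := ℝ) (φ := fun _ : Fin 2 => ℝ) 0).hasFDerivAt.congr_fderiv ?_
  ext v
  simp [covector_apply]

theorem coord_one (x : Fin 2 → ℝ) : HasPartials (fun y => y 1) 0 1 x := by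
  refine (ContinuousLinearMap.proj (R := ℝ) (φ := fun _ : Fin 2 => ℝ) 1).hasFDerivAt.congr_fderiv ?_
  ext v
  simp [covector_apply]

theorem coord_last (x : Fin 2 → ℝ) : HasPartials (fun y => 1 - y 0 - y 1) (-1) (-1) x := by
  refine ((HasFDerivAt.const_sub (coord_zero x) (1 : ℝ)).sub (coord_one x)).congr_fderiv ?_
  ext v
  simp only [_root_.sub_apply, _root_.neg_apply, covector_apply]
  ring

end HasPartials

/-- The open triangle of the `x : ℝ²` with `x₀, x₁, 1 - x₀ - x₁ > 0`. -/
def triangle : Set (Fin 2 → ℝ) := {x | 0 < x 0 ∧ 0 < x 1 ∧ 0 < 1 - x 0 - x 1}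

theorem isOpen_triangle : IsOpen triangle := by
  have h0 : IsOpen {x : Fin 2 → ℝ | 0 < x 0} := isOpen_lt (by fun_prop) (by fun_prop)
  have h1 : IsOpen {x : Fin 2 → ℝ | 0 < x 1} := isOpen_lt (by fun_prop) (by fun_prop)
  have h2 : IsOpen {x : Fin 2 → ℝ | 0 < 1 - x 0 - x 1} := isOpen_lt (by fun_prop) (by fun_prop)
  exact h0.inter (h1.inter h2)

/-! ### Curvature of a separable metric on the plane. -/

section Separable

/-- The metric `w(x₀) dx₀² + w(x₁) dx₁² + w(x₂) dx₂²` restricted to the plane `x₀ + x₁ + x₂ = 1`,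
in the coordinates `(x₀, x₁)`. -/
def separableMetric (w : ℝ → ℝ) (x : Fin 2 → ℝ) : Matrix (Fin 2) (Fin 2) ℝ :=
  !![w (x 0) + w (1 - x 0 - x 1), w (1 - x 0 - x 1);
    w (1 - x 0 - x 1), w (x 1) + w (1 - x 0 - x 1)]

/-- The determinant of `separableMetric w`. -/
def separableDet (w : ℝ → ℝ) (x : Fin 2 → ℝ) : ℝ :=
  w (x 0) * w (x 1) + w (x 1) * w (1 - x 0 - x 1) + w (1 - x 0 - x 1) * w (x 0)

theorem separableDet_pos {w : ℝ → ℝ} (hw : ∀ t, 0 < t → 0 < w t) {x : Fin 2 → ℝ}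
    (hx : x ∈ triangle) : 0 < separableDet w x := by
  have h0 := hw _ hx.1
  have h1 := hw _ hx.2.1
  have h2 := hw _ hx.2.2
  unfold separableDet
  positivity

/-- The matrix `M` is kept general so that the inverse of `g x` can be rewritten for a `g` that is
separable only on the triangle. -/
theorem inv_eq_of_eq_separableMetric {w : ℝ → ℝ} {x : Fin 2 → ℝ} {M : Matrix (Fin 2) (Fin 2) ℝ}
    (hM : M = separableMetric w x) (hD : separableDet w x ≠ 0) :
    M⁻¹ = !![(w (x 1) + w (1 - x 0 - x 1)) / separableDet w x,
        -w (1 - x 0 - x 1) / separableDet w x;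
      -w (1 - x 0 - x 1) / separableDet w x,
        (w (x 0) + w (1 - x 0 - x 1)) / separableDet w x] := by
  subst hM
  apply Matrix.inv_eq_right_inv
  ext i j
  fin_cases i <;> fin_cases j <;>
    simp [separableMetric, Matrix.mul_apply, Fin.sum_univ_two] <;>
    field_simp <;> unfold separableDet <;> ring

variable {g : (Fin 2 → ℝ) → Matrix (Fin 2) (Fin 2) ℝ} {w w' w'' : ℝ → ℝ}

/-- Derivatives are local and the triangle is open, so agreement there suffices. The minus signs
come from the third coordinate `1 - x₀ - x₁`. -/
theorem hasPartials_of_eqOn_separableMetric (hg : Set.EqOn g (separableMetric w) triangle)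
    (hw' : ∀ t, 0 < t → HasDerivAt w (w' t) t) {x : Fin 2 → ℝ} (hx : x ∈ triangle) :
    HasPartials (fun y => g y 0 0) (w' (x 0) - w' (1 - x 0 - x 1)) (-w' (1 - x 0 - x 1)) x ∧
    HasPartials (fun y => g y 0 1) (-w' (1 - x 0 - x 1)) (-w' (1 - x 0 - x 1)) x ∧
    HasPartials (fun y => g y 1 0) (-w' (1 - x 0 - x 1)) (-w' (1 - x 0 - x 1)) x ∧
    HasPartials (fun y => g y 1 1) (-w' (1 - x 0 - x 1)) (w' (x 1) - w' (1 - x 0 - x 1)) x := by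
  have hev : g =ᶠ[nhds x] separableMetric w :=
    hg.eventuallyEq_of_mem (isOpen_triangle.mem_nhds hx)
  have hA := (HasPartials.coord_zero x).scomp (hw' _ hx.1)
  have hB := (HasPartials.coord_one x).scomp (hw' _ hx.2.1)
  have hC := (HasPartials.coord_last x).scomp (hw' _ hx.2.2)
  refine ⟨?_, ?_, ?_, ?_⟩
  · refine HasPartials.congr_of_eventuallyEq ?_ (hev.fun_comp (fun M => M 0 0))
    convert hA.add hC using 1 <;> first | rfl | ring
  · refine HasPartials.congr_of_eventuallyEq ?_ (hev.fun_comp (fun M => M 0 1))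
    convert hC using 1 <;> first | rfl | ring
  · refine HasPartials.congr_of_eventuallyEq ?_ (hev.fun_comp (fun M => M 1 0))
    convert hC using 1 <;> first | rfl | ring
  · refine HasPartials.congr_of_eventuallyEq ?_ (hev.fun_comp (fun M => M 1 1))
    convert hB.add hC using 1 <;> first | rfl | ring

/-- The numerators of the Christoffel symbols `Γᵏᵢⱼ` of `separableMetric w` over the denominator
`2 * separableDet w`. -/
def christoffelNum (w w' : ℝ → ℝ) (k i j : Fin 2) (x : Fin 2 → ℝ) : ℝ :=
  ![![![(w (x 1) + w (1 - x 0 - x 1)) * w' (x 0) - w (x 1) * w' (1 - x 0 - x 1),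
        -(w (x 1) * w' (1 - x 0 - x 1))],
      ![-(w (x 1) * w' (1 - x 0 - x 1)),
        -(w (x 1) * w' (1 - x 0 - x 1) + w (1 - x 0 - x 1) * w' (x 1))]],
    ![![-(w (x 0) * w' (1 - x 0 - x 1) + w (1 - x 0 - x 1) * w' (x 0)),
        -(w (x 0) * w' (1 - x 0 - x 1))],
      ![-(w (x 0) * w' (1 - x 0 - x 1)),
        (w (x 0) + w (1 - x 0 - x 1)) * w' (x 1) - w (x 0) * w' (1 - x 0 - x 1)]]] k i j

theorem christoffel_eq (hg : Set.EqOn g (separableMetric w) triangle)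
    (hw : ∀ t, 0 < t → 0 < w t) (hw' : ∀ t, 0 < t → HasDerivAt w (w' t) t)
    {x : Fin 2 → ℝ} (hx : x ∈ triangle) (k i j : Fin 2) :
    christoffel g k i j x = christoffelNum w w' k i j x / (2 * separableDet w x) := by
  obtain ⟨h00, h01, h10, h11⟩ := hasPartials_of_eqOn_separableMetric hg hw' hx
  have hD := (separableDet_pos hw hx).ne'
  rw [christoffel, inv_eq_of_eq_separableMetric (hg hx) hD]
  fin_cases k <;> fin_cases i <;> fin_cases j <;>
    simp [Fin.sum_univ_two, h00.pderiv_zero, h00.pderiv_one, h01.pderiv_zero, h01.pderiv_one,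
      h10.pderiv_zero, h10.pderiv_one, h11.pderiv_zero, h11.pderiv_one, christoffelNum] <;>
    field_simp <;> ring

/-- The scalar curvature of `w(x₀) dx₀² + w(x₁) dx₁² + w(x₂) dx₂²` on the plane
`x₀ + x₁ + x₂ = 1`. -/
theorem scalar_eq (hg : Set.EqOn g (separableMetric w) triangle)
    (hw : ∀ t, 0 < t → 0 < w t) (hw' : ∀ t, 0 < t → HasDerivAt w (w' t) t)
    (hw'' : ∀ t, 0 < t → HasDerivAt w' (w'' t) t) {x : Fin 2 → ℝ} (hx : x ∈ triangle) :
    scalar g x = (w (x 0) * w' (x 1) * w' (1 - x 0 - x 1)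
      + w (x 1) * w' (x 0) * w' (1 - x 0 - x 1)
      + w (1 - x 0 - x 1) * w' (x 0) * w' (x 1)) / (2 * separableDet w x ^ 2) := by
  have hA := (HasPartials.coord_zero x).scomp (hw' _ hx.1)
  have hB := (HasPartials.coord_one x).scomp (hw' _ hx.2.1)
  have hC := (HasPartials.coord_last x).scomp (hw' _ hx.2.2)
  have ha := (HasPartials.coord_zero x).scomp (hw'' _ hx.1)
  have hb := (HasPartials.coord_one x).scomp (hw'' _ hx.2.1)
  have hc := (HasPartials.coord_last x).scomp (hw'' _ hx.2.2)
  have hDpos := separableDet_pos hw hx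
  have hD := ((hA.mul hB).add (hB.mul hC)).add (hC.mul hA)
  -- The denominator `2 * D` is written `D + D`, so that its partials follow from `add`.
  have h2D := hD.add hD
  have hne : separableDet w x + separableDet w x ≠ 0 := by positivity
  -- The closed form of `Γ` holds near `x`, not only at `x`, so it may be differentiated.
  have hΓ {k i j : Fin 2} {p q : ℝ}
      (h : HasPartials (fun y => christoffelNum w w' k i j y /
        (separableDet w y + separableDet w y)) p q x) :
      HasPartials (christoffel g k i j) p q x := by
    refine h.congr_of_eventuallyEq ?_
    filter_upwards [isOpen_triangle.mem_nhds hx] with y hy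
    rw [christoffel_eq hg hw hw' hy, two_mul]
  have h000 := hΓ (k := 0) (i := 0) (j := 0) ((((hB.add hC).mul ha).sub (hB.mul hc)).div h2D hne)
  have h001 := hΓ (k := 0) (i := 0) (j := 1) ((hB.mul hc).neg.div h2D hne)
  have h010 := hΓ (k := 0) (i := 1) (j := 0) ((hB.mul hc).neg.div h2D hne)
  have h011 := hΓ (k := 0) (i := 1) (j := 1) (((hB.mul hc).add (hC.mul hb)).neg.div h2D hne)
  have h100 := hΓ (k := 1) (i := 0) (j := 0) (((hA.mul hc).add (hC.mul ha)).neg.div h2D hne)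
  have h101 := hΓ (k := 1) (i := 0) (j := 1) ((hA.mul hc).neg.div h2D hne)
  have h110 := hΓ (k := 1) (i := 1) (j := 0) ((hA.mul hc).neg.div h2D hne)
  have h111 := hΓ (k := 1) (i := 1) (j := 1)
    ((((hA.add hC).mul hb).sub (hA.mul hc)).div h2D hne)
  simp only [scalar, ricci, riemann, Fin.sum_univ_two,
    inv_eq_of_eq_separableMetric (hg hx) hDpos.ne',
    h000.pderiv_zero, h000.pderiv_one, h001.pderiv_zero, h001.pderiv_one,
    h010.pderiv_zero, h011.pderiv_zero,
    h100.pderiv_one, h101.pderiv_one,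
    h110.pderiv_zero, h110.pderiv_one, h111.pderiv_zero, h111.pderiv_one,
    christoffel_eq hg hw hw' hx]
  simp [christoffelNum]
  -- The determinant stays one nonzero symbol while denominators are cleared; expanding it
  -- afterwards leaves a polynomial identity in which `w''` cancels.
  generalize hDD : separableDet w x = D at *
  have hD0 : D ≠ 0 := hDpos.ne'
  unfold separableDet at hDD
  field_simp
  simp only [← hDD]
  ring

end Separable

end RiemannCoord

/-! ### The metric `g_α` as a separable metric. -/

namespace AlphaGeometry

open RiemannCoord

theorem chart_mem_triangle {θ : Fin 3 → ℝ} (hθ : θ ∈ P 3) : chart θ ∈ triangle := by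
  have h := hθ.2
  rw [Fin.sum_univ_three] at h
  refine ⟨hθ.1 0, hθ.1 1, ?_⟩
  have : (0 : ℝ) < θ 2 := hθ.1 2
  change 0 < 1 - θ 0 - θ 1
  linarith

/-- The derivative of the components of `φ_α`. -/
theorem hasDerivAt_phi_component (α : ℝ) {t : ℝ} (ht : 0 < t) :
    HasDerivAt (fun s => if α = 1 then Real.log s else 2 / (1 - α) * s ^ ((1 - α) / 2))
      (t ^ (-(1 + α) / 2)) t := by
  by_cases h : α = 1
  · subst h
    simp only [if_true]
    convert Real.hasDerivAt_log ht.ne' using 1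
    rw [← Real.rpow_neg_one]
    norm_num
  · simp only [h, if_false]
    have h1 : 1 - α ≠ 0 := sub_ne_zero.2 (Ne.symm h)
    refine ((Real.hasDerivAt_rpow_const (p := (1 - α) / 2) (Or.inl ht.ne')).const_mul
      (2 / (1 - α))).congr_deriv ?_
    rw [show (1 - α) / 2 - 1 = -(1 + α) / 2 by ring]
    field_simp

theorem metric_eqOn_separableMetric (α : ℝ) :
    Set.EqOn (metric α 2) (separableMetric fun t => t ^ (-(1 + α))) triangle := by
  intro x hx
  have h0 := (HasPartials.coord_zero x).scomp (hasDerivAt_phi_component α hx.1)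
  have h1 := (HasPartials.coord_one x).scomp (hasDerivAt_phi_component α hx.2.1)
  have h2 := (HasPartials.coord_last x).scomp (hasDerivAt_phi_component α hx.2.2)
  have hsq {t : ℝ} (ht : 0 < t) : t ^ (-(1 + α) / 2) * t ^ (-(1 + α) / 2) = t ^ (-(1 + α)) := by
    rw [← Real.rpow_add ht]
    ring_nf
  have hlast (y : Fin 2 → ℝ) : param y 2 = 1 - y 0 - y 1 := by
    change param y (Fin.last 2) = _
    rw [param, Fin.snoc_last, Fin.sum_univ_two]
    ring
  have hF : HasFDerivAt (fun y => phi α 3 (param y)) (ContinuousLinearMap.pi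
      ![covector (x 0 ^ (-(1 + α) / 2) * 1) (x 0 ^ (-(1 + α) / 2) * 0),
        covector (x 1 ^ (-(1 + α) / 2) * 0) (x 1 ^ (-(1 + α) / 2) * 1),
        covector ((1 - x 0 - x 1) ^ (-(1 + α) / 2) * -1)
          ((1 - x 0 - x 1) ^ (-(1 + α) / 2) * -1)]) x := by
    rw [hasFDerivAt_pi]
    intro k
    fin_cases k
    · exact h0
    · exact h1
    · simp only [phi]
      change HasFDerivAt (fun y => if α = 1 then Real.log (param y 2)
        else 2 / (1 - α) * param y 2 ^ ((1 - α) / 2)) _ x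
      simp only [hlast]
      exact h2
  ext i j
  simp only [metric, pullbackMetric, Matrix.of_apply, pderiv, hF.fderiv]
  refine (Fin.sum_univ_three _).trans ?_
  fin_cases i <;> fin_cases j <;>
    -- Without `-neg_add_rev`, `simp` would rewrite the exponent `-(1 + α)` out of the form used by
    -- `hsq`.
    simp [covector_apply, separableMetric, hsq hx.1, hsq hx.2.1, hsq hx.2.2, -neg_add_rev]

end AlphaGeometry

end

theorem mainTheorem2 (α : ℝ) (θ : Fin 3 → ℝ) (hθ : θ ∈ AlphaGeometry.P 3) :
    AlphaGeometry.Scal α θ =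
      (1 + α) ^ 2 / 2 *
        (θ 0 ^ α * θ 1 ^ α * θ 2 ^ α /
          (θ 0 ^ (α + 1) + θ 1 ^ (α + 1) + θ 2 ^ (α + 1)) ^ 2) := by
  have hsum := hθ.2
  rw [Fin.sum_univ_three] at hsum
  have hpow {t : ℝ} (ht : 0 < t) (s : ℝ) :
      HasDerivAt (fun u : ℝ => u ^ s) (s * t ^ (s - 1)) t :=
    Real.hasDerivAt_rpow_const (Or.inl ht.ne')
  rw [AlphaGeometry.Scal, RiemannCoord.scalar_eq (AlphaGeometry.metric_eqOn_separableMetric α)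
    (fun t ht => Real.rpow_pos_of_pos ht _) (fun t ht => hpow ht _)
    (fun t ht => (hpow ht _).const_mul _) (AlphaGeometry.chart_mem_triangle hθ)]
  have hx : 0 < θ 0 := hθ.1 0
  have hy : 0 < θ 1 := hθ.1 1
  have hz : 0 < θ 2 := hθ.1 2
  have h2 : 1 - θ 0 - θ 1 = θ 2 := by linarith
  have hc0 : AlphaGeometry.chart θ 0 = θ 0 := rfl
  have hc1 : AlphaGeometry.chart θ 1 = θ 1 := rfl
  have hneg {t : ℝ} (ht : 0 < t) : t ^ (-(1 + α)) = (t ^ α * t)⁻¹ := by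
    rw [Real.rpow_neg ht.le, add_comm, Real.rpow_add_one ht.ne']
  simp only [RiemannCoord.separableDet, hc0, hc1, h2, Real.rpow_sub_one hx.ne',
    Real.rpow_sub_one hy.ne', Real.rpow_sub_one hz.ne', hneg hx, hneg hy, hneg hz,
    Real.rpow_add_one hx.ne', Real.rpow_add_one hy.ne', Real.rpow_add_one hz.ne']
  have hX := Real.rpow_pos_of_pos hx α
  have hY := Real.rpow_pos_of_pos hy α
  have hZ := Real.rpow_pos_of_pos hz α
  -- All exponents are now reduced to `α`, so the powers can be treated as independent positive
  -- numbers.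
  generalize θ 0 ^ α = X at *
  generalize θ 1 ^ α = Y at *
  generalize θ 2 ^ α = Z at *
  have hdet : (X * θ 0)⁻¹ * (Y * θ 1)⁻¹ + (Y * θ 1)⁻¹ * (Z * θ 2)⁻¹ + (Z * θ 2)⁻¹ * (X * θ 0)⁻¹
      = (X * θ 0 + Y * θ 1 + Z * θ 2) / ((X * θ 0) * (Y * θ 1) * (Z * θ 2)) := by
    field_simp
    ring
  have hS : X * θ 0 + Y * θ 1 + Z * θ 2 ≠ 0 := by positivity
  rw [hdet]
  field_simp
  -- What remains is the factor `θ₀ + θ₁ + θ₂` of the numerator, equal to `1`.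
  linear_combination (1 + α) ^ 2 * hsum
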